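/- **Notation.** For a bounded set of ordinals $a$ let $\mathrm{ssup}(a)=\sup\{\alpha+1\mid\alpha\in a\}$, $\mathrm{acc}^+(a)=\{\alpha<\mathrm{ssup}(a)\mid \sup(a\cap\alpha)=\alpha>0\}$ and $\mathrm{acc}(a)=a\cap\mathrm{acc}^+(a)$. For a coloring $c:[\kappa]^2\to\theta$ write $c(\alpha,\beta)$ for $c(\{\alpha,\beta\})$ when $\alpha<\beta$, and for $\beta<\kappa$, $i\le\theta$ let $D^c_{\le i}(\beta)=\{\alpha<\beta\mid c(\alpha,\beta)\le i\}$. * $c$ is *closed* if $\mathrm{acc}^+(D^c_{\le i}(\beta))\subseteq D^c_{\le i}(\beta)$ for all $\beta<\kappa$ and $i\le\theta$. * $c$ *witnesses* $\mathrm U(\kappa,\mu,\theta,\chi')$ if for every $\sigma<\chi'$, every pairwise disjoint family $\mathcal A\subseteq[\kappa]^\sigma$ of size $\kappa$ and every $i<\theta$, there is $\mathcal B\subseteq\mathcal A$ with $|\mathcal B|=\mu$ such that $\min(c[a\times b])>i$ for all $a,b\in\mathcal B$ with $a<b$ (that is, all elements of $a$ are below all elements of $b$). * $c$ is *subadditive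 of the second kind* if $c(\alpha,\beta)\le\max\{c(\alpha,\gamma),c(\beta,\gamma)\}$ for all $\alpha<\beta<\gamma<\kappa$. * $\partial(c)=\{\beta\in\mathrm{acc}(\kappa)\mid\forall\gamma<\kappa\,\forall i<\theta\ \sup(D^c_{\le i}(\gamma)\cap\beta)<\beta\}$, and $E^\kappa_\chi=\{\alpha<\kappa\mid\mathrm{cf}(\alpha)=\chi\}$. * $\kappa$ is *$({<}\chi)$-inaccessible* if $\nu^\mu<\kappa$ for all $\nu<\kappa$ and $\mu<\chi$. A poset is *well-met* if any two compatible conditions have a greatest lower bound; it is *$\chi$-directed closed with greatest lower bounds* if every (possibly empty) directed set of fewer than $\chi$ conditions has a greatest lower bound; it is *$\kappa$-cc* if every antichain (set of pairwise incompatible conditions) has size less than $\kappa$. A suborder $Q\subseteq\mathbb P$ is *regular* if elements incompatible in $Q$ are incompatible in $\mathbb P$, and for every $p\in\mathbb P$ there is $q\in Q$ such that every $r\le q$ in $Q$ is compatible with $p$ in $\mathbb P$. $\mathbb P$ is *$\kappa$-stationarily layered* if the collection of regular suborders of $\mathbb P$ of size less than $\kappa$ is stationary in $\mathcal P_\kappa(\mathbb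 P)$, i.e. meets every closed unbounded subset of $\mathcal P_\kappa(\mathbb P)=\{x\subseteq\mathbb P\mid |x|<\kappa\}$. Products are full-support products ordered coordinatewise. **Theorem.** Suppose that $\theta\le\chi<\kappa$ are infinite regular cardinals, $\kappa$ is $({<}\chi)$-inaccessible, and $c:[\kappa]^2\to\theta$ is a closed witness to $\mathrm U(\kappa,2,\theta,2)$ that is subadditive of the second kind. Then: 1. There is a sequence of posets $\langle\mathbb P_i\mid i<\theta\rangle$ such that (a) for all $i<\theta$, $\mathbb P_i$ is well-met and $\chi$-directed closed with greatest lower bounds; (b) for all $j<\theta$, $\prod_{i<j}\mathbb P_i$ is $\kappa$-stationarily layered; (c) $\prod_{i<\theta}\mathbb P_i$ is not $\kappa$-cc. 2. If $\partial(c)\cap E^\kappa_\chi$ is stationary in $\kappa$, then there is a poset $\mathbb P$ such that (a) $\mathbb P$ is well-met and $\chi$-directed closed with greatest lower bounds; (b) for all $j<\theta$, $\mathbb P^j$ is $\kappa$-stationarily layered; (c) $\mathbb P^\theta$ is not $\kappa$-cc. -/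

import Mathlib

open Cardinal Ordinal

universe u v

/-! ## Sets of ordinals -/

/-- The strong supremum `sup {α + 1 | α ∈ a}` of a bounded set of ordinals. -/
noncomputable def ssup (a : Set Ordinal.{u}) : Ordinal.{u} :=
  sSup (Order.succ '' a)

/-- `acc⁺(a) = {α < ssup(a) | sup (a ∩ α) = α > 0}`, for a bounded set of ordinals `a`. -/
def accPlus (a : Set Ordinal.{u}) : Set Ordinal.{u} :=
  {α | α < ssup a ∧ sSup (a ∩ Set.Iio α) = α ∧ 0 < α}

/-- `acc(a) = a ∩ acc⁺(a)`, for a bounded set of ordinals `a`. -/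
def acc (a : Set Ordinal.{u}) : Set Ordinal.{u} :=
  a ∩ accPlus a

/-- `E^κ_χ`, the set of ordinals below `κ` of cofinality `χ`. -/
def cofSet (κ χ : Cardinal.{u}) : Set Ordinal.{u} :=
  {α | α < κ.ord ∧ α.cof = χ}

/-- `S ⊆ κ` is stationary in `κ`: it meets every closed unbounded subset of `κ`. -/
def StationaryIn (κ : Cardinal.{u}) (S : Set Ordinal.{u}) : Prop :=
  IsStationary {x : Set.Iio κ.ord | (x : Ordinal.{u}) ∈ S}

/-- `κ` is `(<χ)`-inaccessible: `ν ^ μ < κ` for all `ν < κ` and `μ < χ`. -/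
def LtInaccessible (κ χ : Cardinal.{u}) : Prop :=
  ∀ ν < κ, ∀ μ < χ, ν ^ μ < κ

/-! ## Colorings of pairs

A coloring `c : [κ]² → θ` is represented by a binary function on ordinals, of which only the
values `c α β` with `α < β < κ` matter. -/

/-- `c` is a coloring from `[κ]²` to `θ`. -/
def IsColoring (κ θ : Cardinal.{u}) (c : Ordinal.{u} → Ordinal.{u} → Ordinal.{u}) : Prop :=
  ∀ α β, α < β → β < κ.ord → c α β < θ.ord

/-- `D^c_{≤ i}(β) = {α < β | c(α, β) ≤ i}`. -/
def levelSet (c : Ordinal.{u} → Ordinal.{u} → Ordinal.{u}) (i β : Ordinal.{u}) :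
    Set Ordinal.{u} :=
  {α | α < β ∧ c α β ≤ i}

/-- `c` is `Σ`-closed. -/
def IsClosedOn (κ θ : Cardinal.{u}) (S : Set Ordinal.{u})
    (c : Ordinal.{u} → Ordinal.{u} → Ordinal.{u}) : Prop :=
  ∀ β < κ.ord, ∀ i ≤ θ.ord, accPlus (levelSet c i β) ∩ S ⊆ levelSet c i β

/-- `c : [κ]² → θ` is closed, i.e. `κ`-closed. -/
def IsClosedColoring (κ θ : Cardinal.{u})
    (c : Ordinal.{u} → Ordinal.{u} → Ordinal.{u}) : Prop :=
  IsClosedOn κ θ (Set.Iio κ.ord) c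

/-- `c` is subadditive of the second kind. -/
def IsSubadditiveSnd (κ : Cardinal.{u})
    (c : Ordinal.{u} → Ordinal.{u} → Ordinal.{u}) : Prop :=
  ∀ α β γ, α < β → β < γ → γ < κ.ord → c α β ≤ max (c α γ) (c β γ)

/-- `[κ]^σ`, the family of subsets of `κ` of cardinality `σ`. -/
def subsetsOfCard (κ σ : Cardinal.{u}) : Set (Set Ordinal.{u}) :=
  {a | a ⊆ Set.Iio κ.ord ∧ #a = Cardinal.lift.{u + 1} σ}

/-- `c : [κ]² → θ` witnesses `U(κ, μ, θ, χ)`: for every `σ < χ`, every pairwise disjoint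
`𝒜 ⊆ [κ]^σ` of size `κ` and every `i < θ` there is `ℬ ⊆ 𝒜` of size `μ` such that
`min (c[a × b]) > i` for all `a < b` from `ℬ`. -/
def WitnessesU (κ μ θ χ : Cardinal.{u})
    (c : Ordinal.{u} → Ordinal.{u} → Ordinal.{u}) : Prop :=
  IsColoring κ θ c ∧
  ∀ σ < χ, ∀ 𝒜 ⊆ subsetsOfCard κ σ, 𝒜.PairwiseDisjoint id →
    #𝒜 = Cardinal.lift.{u + 1} κ →
    ∀ i < θ.ord, ∃ ℬ ⊆ 𝒜, #ℬ = Cardinal.lift.{u + 1} μ ∧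
      ∀ a ∈ ℬ, ∀ b ∈ ℬ, a ≠ b → (∀ α ∈ a, ∀ β ∈ b, α < β) →
        ∀ α ∈ a, ∀ β ∈ b, i < c α β

/-- `∂(c)`, the set of levels of divergence of a coloring `c : [κ]² → θ`. -/
def divergenceLevels (κ θ : Cardinal.{u})
    (c : Ordinal.{u} → Ordinal.{u} → Ordinal.{u}) : Set Ordinal.{u} :=
  {β | β ∈ acc (Set.Iio κ.ord) ∧
    ∀ γ < κ.ord, ∀ i < θ.ord, sSup (levelSet c i γ ∩ Set.Iio β) < β}

/-! ## Posets (smaller conditions are stronger) -/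

/-- `p` and `q` have a common lower bound in `Q`. -/
def CompatIn {P : Type v} [Preorder P] (Q : Set P) (p q : P) : Prop :=
  ∃ r ∈ Q, r ≤ p ∧ r ≤ q

/-- Any two compatible conditions have a greatest lower bound. -/
def WellMet (P : Type v) [Preorder P] : Prop :=
  ∀ p q : P, CompatIn Set.univ p q → ∃ r, IsGLB {p, q} r

/-- `P` is `χ`-directed closed with greatest lower bounds: every directed set of fewer than `χ`
conditions has a greatest lower bound. The empty set is allowed, so that `P` has a greatest
element. -/
def DirectedClosedGLB (χ : Cardinal.{v}) (P : Type v) [Preorder P] : Prop :=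
  ∀ D : Set P, DirectedOn (· ≥ ·) D → #D < χ → ∃ r, IsGLB D r

/-- The `κ`-chain condition: every antichain (set of pairwise incompatible conditions) has size
less than `κ`. -/
def ChainCondition (κ : Cardinal.{v}) (P : Type v) [Preorder P] : Prop :=
  ∀ A : Set P, A.Pairwise (fun p q => ¬ CompatIn Set.univ p q) → #A < κ

/-- `Q` is a regular suborder of `P` (the inclusion is a complete embedding): incompatible elements
of `Q` remain incompatible in `P`, and every `p ∈ P` has a reduction to `Q`, that is, some `q ∈ Q`
such that every `r ∈ Q` below `q` is compatible with `p`. -/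
def IsRegularSuborder {P : Type v} [Preorder P] (Q : Set P) : Prop :=
  (∀ q ∈ Q, ∀ r ∈ Q, CompatIn Set.univ q r → CompatIn Q q r) ∧
  ∀ p : P, ∃ q ∈ Q, ∀ r ∈ Q, r ≤ q → CompatIn Set.univ r p

/-- `C` is a closed unbounded subset of `𝒫_κ(A)`, the family of subsets of `A` of size
less than `κ`. -/
def IsClubPk (κ : Cardinal.{v}) {A : Type v} (C : Set (Set A)) : Prop :=
  (∀ x ∈ C, #x < κ) ∧
  (∀ x : Set A, #x < κ → ∃ y ∈ C, x ⊆ y) ∧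
  (∀ 𝒟 ⊆ C, 𝒟.Nonempty → IsChain (· ⊆ ·) 𝒟 → #𝒟 < κ → ⋃₀ 𝒟 ∈ C)

/-- `S` is a stationary subset of `𝒫_κ(A)`. -/
def IsStationaryPk (κ : Cardinal.{v}) {A : Type v} (S : Set (Set A)) : Prop :=
  (∀ x ∈ S, #x < κ) ∧ ∀ C : Set (Set A), IsClubPk κ C → (S ∩ C).Nonempty

/-- `P` is `κ`-stationarily layered: the collection of regular suborders of `P` of size less than
`κ` is stationary in `𝒫_κ(P)`. -/
def StationarilyLayered (κ : Cardinal.{v}) (P : Type v) [Preorder P] : Prop :=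
  IsStationaryPk κ {Q : Set P | #Q < κ ∧ IsRegularSuborder Q}

/-!
Points of `κ` are elements of `κ.ord.ToType`, and `D i β` denotes the level set
`{α < β | c(α, β) ≤ i}`. Subadditivity of the second kind says that the points of `D i β` are
pairwise adjacent in the graph joining each `β` to the points of `D i β`, and `U(κ, 2, θ, 2)` says
that this graph has no complete subgraph of size `κ`. The posets consist of independent sets
of size less than `χ` of such graphs, on a set `Γ` of `κ` many vertices, ordered by reverse inclusion.
Unions of conditions give the greatest lower bounds. The full product over all levels is not
`κ`-cc because any two points are adjacent in some level (`IsLevelSystem.not_chainCondition`).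

The set `Γ` consists of successor points `β` all of which receive the same color `j` with their
predecessor. A level set at such a `β` contains the predecessor as soon as `j ≤ i`, so it is closed
in `β`, whereas in general a closed coloring only has level sets closed below their supremum
(`exists_isLevelSystem`).

A product of fewer than `χ` such posets is stationarily layered if stationarily many `δ` of
cofinality at least `χ` have the property that the level sets at points of `Γ` above `δ` are bounded
below `δ` (`IsLevelSystem.stationarilyLayered_pi`). The regular suborders are formed by the
conditions contained in `δ`, and the heart of the matter is `IsLevelSystem.exists_reduction`. A set
`D i β ∩ δ` that is nonempty and bounded in `δ` has a largest point `η`, and is contained in the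
clique `D i η ∪ {η}`, which is coded below `δ`. Enlarging the part of a condition below `δ` to be
maximal with respect to these cliques, and then reflecting the part above `δ`, yields a condition
below `δ` none of whose extensions below `δ` meets any of the sets `D i β ∩ δ`.

In the second part, the levels of divergence of cofinality `χ` are as required. In the first
part, the case `2 ^ θ ≥ κ` is settled by posets with just two incompatible conditions below a
greatest one, since their full product has `2 ^ θ` incompatible conditions. Otherwise,
each level admits two stationary sets such that each point of `Γ` is as required for one of them
(`IsLevelSystem.exists_stationary_pair`), and the pigeonhole principle,
applied to the functions from `θ` to `2`, provides `κ` many points of `Γ` that are as required for the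
same sequence of stationary sets. Finally, stationarity is only used through closure points of
functions (`MeetsClosurePoints`), which avoids closed unbounded sets and their intersections.
-/

/-! ### Stationarity in terms of closure points -/

section Regular

variable {κ χ : Cardinal.{u}}

theorem mk_Iio_ord_lt (i : κ.ord.ToType) : #(Set.Iio i) < κ := by
  simpa using mk_Iio_lt i (by simp)

/-- Subsets of size less than `κ` of the order `κ` are strictly bounded, for `κ` regular. -/
theorem exists_forall_lt_of_mk_lt (hκ : κ.IsRegular) (s : Set κ.ord.ToType) (hs : #s < κ) :
    ∃ ξ, ∀ x ∈ s, x < ξ := by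
  have := Cardinal.noMaxOrder hκ.aleph0_le
  by_contra! h
  have hc : IsCofinal s := fun ξ => by
    obtain ⟨x, hx, hxξ⟩ := h ξ
    exact ⟨x, hx, hxξ⟩
  have := Order.cof_le hc
  rw [cof_toType, hκ.cof_ord] at this
  exact absurd hs this.not_gt

/-- Families indexed by fewer than `κ` elements are strictly bounded in the order `κ`. -/
theorem exists_forall_lt_of_mk_index_lt (hκ : κ.IsRegular) {ι : Type u} (hι : #ι < κ)
    (f : ι → κ.ord.ToType) : ∃ ξ, ∀ i, f i < ξ := by
  obtain ⟨ξ, hξ⟩ := exists_forall_lt_of_mk_lt hκ (Set.range f) (mk_range_le.trans_lt hι)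
  exact ⟨ξ, fun i => hξ _ ⟨i, rfl⟩⟩

/-- A monotone strict upper bound of a function on the order `κ`. -/
theorem exists_bound_below (hκ : κ.IsRegular) (g : κ.ord.ToType → κ.ord.ToType) :
    ∃ G : κ.ord.ToType → κ.ord.ToType, ∀ ξ η, η ≤ ξ → g η < G ξ := by
  have : ∀ ξ, ∃ ζ, ∀ η : Set.Iic ξ, g η.1 < ζ := fun ξ => by
    have := Cardinal.noMaxOrder hκ.aleph0_le
    refine exists_forall_lt_of_mk_index_lt hκ ?_ _
    obtain ⟨ζ, hζ⟩ := exists_gt ξ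
    exact (mk_le_mk_of_subset fun x hx => lt_of_le_of_lt hx hζ).trans_lt (mk_Iio_ord_lt ζ)
  choose G hG using this
  exact ⟨G, fun ξ η h => hG ξ ⟨η, h⟩⟩

/-- `δ` is closed under the function `g`. -/
def ClosedUnder {V : Type u} [LT V] (g : V → V) (δ : V) : Prop :=
  ∀ ξ < δ, g ξ < δ

/-- Stationarity of a set of limit points, phrased without closed sets: every function has a
closure point in `S`. -/
def MeetsClosurePoints {V : Type u} [LT V] (S : Set V) : Prop :=
  ∀ g : V → V, ∃ δ ∈ S, ClosedUnder g δ

/-- The points of cofinality at least `χ`, for infinite `χ`: every set of fewer than `χ` smaller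
points has a strict upper bound below `δ`. -/
def HasCofGE {V : Type u} [LT V] (χ : Cardinal.{u}) (δ : V) : Prop :=
  ∀ s : Set V, (∀ x ∈ s, x < δ) → #s < χ → ∃ ξ < δ, ∀ x ∈ s, x < ξ

theorem MeetsClosurePoints.mono {V : Type u} [LT V] {S T : Set V} (hS : MeetsClosurePoints S)
    (h : S ⊆ T) : MeetsClosurePoints T := fun g => by
  obtain ⟨δ, hδ, hg⟩ := hS g
  exact ⟨δ, h hδ, hg⟩

theorem MeetsClosurePoints.inter_closedUnder {V : Type u} [LinearOrder V] {S : Set V}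
    (hS : MeetsClosurePoints S) (g : V → V) : MeetsClosurePoints {δ ∈ S | ClosedUnder g δ} :=
  fun g' => by
    obtain ⟨δ, hδ, hg⟩ := hS fun ξ => max (g ξ) (g' ξ)
    exact ⟨δ, ⟨hδ, fun ξ hξ => (le_max_left _ _).trans_lt (hg ξ hξ)⟩,
      fun ξ hξ => (le_max_right _ _).trans_lt (hg ξ hξ)⟩

/-- The points of `κ` of cofinality at least `χ` form a stationary set. -/
theorem meetsClosurePoints_hasCofGE (hκ : κ.IsRegular) (hχ : χ.IsRegular) (hχκ : χ < κ) :
    MeetsClosurePoints {δ : κ.ord.ToType | HasCofGE χ δ} := by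
  intro g
  obtain ⟨G, hG⟩ := exists_bound_below hκ g
  -- `G` need not be inflationary, hence the maximum with the identity
  have step : ∀ (x : χ.ord.ToType) (h : Set.Iio x → κ.ord.ToType),
      ∃ ξ, ∀ y, max (h y) (G (h y)) < ξ := fun x h =>
    exists_forall_lt_of_mk_index_lt hκ ((mk_Iio_ord_lt x).trans hχκ) _
  choose F hF using step
  let h : χ.ord.ToType → κ.ord.ToType := wellFounded_lt.fix fun x ih => F x fun y => ih y.1 y.2
  have hh : ∀ x y, y < x → max (h y) (G (h y)) < h x := fun x y hy => by
    have : h x = F x fun y => h y.1 := wellFounded_lt.fix_eq _ x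
    rw [this]
    exact hF x (fun y => h y.1) ⟨y, hy⟩
  have := Cardinal.noMaxOrder hχ.aleph0_le
  let B : Set κ.ord.ToType := {ξ | ∀ x, h x < ξ}
  have hB : B.Nonempty := exists_forall_lt_of_mk_index_lt hκ (by simpa using hχκ) h
  have hmin : ∀ ξ < wellFounded_lt.min B hB, ∃ x, ξ ≤ h x := fun ξ hξ => by
    by_contra! hc
    exact wellFounded_lt.not_lt_min B (x := ξ) hc hξ
  have hmem : ∀ x, h x < wellFounded_lt.min B hB := wellFounded_lt.min_mem B hB
  refine ⟨wellFounded_lt.min B hB, fun s hs hsχ => ?_, fun ξ hξ => ?_⟩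
  · have : Nonempty χ.ord.ToType := by simpa using hχ.ne_zero
    choose! x hx using fun y (hy : y ∈ s) => hmin y (hs y hy)
    obtain ⟨z, hz⟩ := exists_forall_lt_of_mk_lt hχ (x '' s) (mk_image_le.trans_lt hsχ)
    refine ⟨h z, hmem z, fun y hy => (hx y hy).trans_lt ?_⟩
    exact (le_max_left _ _).trans_lt (hh _ _ (hz _ ⟨y, hy, rfl⟩))
  · obtain ⟨x, hx⟩ := hmin ξ hξ
    obtain ⟨z, hz⟩ := exists_gt x
    exact (hG _ _ hx).trans ((le_max_right _ _).trans_lt ((hh _ _ hz).trans (hmem z)))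

/-- Diagonal intersections: if no `N v` is stationary, some function has closure points only outside
all the `N v` of smaller index. -/
theorem exists_diagonal_closure (hκ : κ.IsRegular) {I : Set κ.ord.ToType}
    (N : κ.ord.ToType → Set κ.ord.ToType) (hN : ∀ v ∈ I, ¬ MeetsClosurePoints (N v)) :
    ∃ G : κ.ord.ToType → κ.ord.ToType, ∀ δ, ClosedUnder G δ → ∀ v ∈ I, v < δ → δ ∉ N v := by
  have : ∀ v, ∃ g : κ.ord.ToType → κ.ord.ToType, v ∈ I → ∀ δ ∈ N v, ¬ ClosedUnder g δ := by
    intro v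
    by_cases hv : v ∈ I
    · have := hN v hv
      unfold MeetsClosurePoints at this
      push Not at this
      exact this.imp fun _ h _ => h
    · exact ⟨id, fun h => absurd h hv⟩
  choose g hg using this
  choose M hM using fun v => exists_bound_below hκ (g v)
  choose G hG using fun ξ => exists_bound_below hκ fun v => M v ξ
  refine ⟨fun ξ => G ξ ξ, fun δ hδ v hv hvδ hmem => hg v hv δ hmem fun ξ hξ => ?_⟩
  exact (hM v (max v ξ) ξ (le_max_right _ _)).trans
    ((hG _ _ v (le_max_left _ _)).trans (hδ _ (max_lt hvδ hξ)))

/-- There are fewer than `κ` subsets of size less than `χ` of a set of size less than `κ`. -/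
theorem mk_small_subsets_lt (hκ : κ.IsRegular) (hχ : χ.IsRegular) (hχκ : χ < κ)
    (hinacc : LtInaccessible κ χ) {A : Type u} (s : Set A) (hs : #s < κ) :
    #{t : Set A | t ⊆ s ∧ #t < χ} < κ := by
  have hsub : {t : Set A | t ⊆ s ∧ #t < χ} ⊆
      ⋃ x : χ.ord.ToType, {t : Set A | t ⊆ s ∧ #t ≤ #(Set.Iio x)} := by
    rintro t ⟨hts, htχ⟩
    refine Set.mem_iUnion.2 ⟨ToType.mk ⟨(#t).ord, ord_lt_ord.2 htχ⟩, hts, ?_⟩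
    have h : (ToType.mk.symm (ToType.mk ⟨(#t).ord, ord_lt_ord.2 htχ⟩) : Ordinal).card = #t := by
      rw [OrderIso.symm_apply_apply, card_ord]
    exact h.ge
  refine (mk_le_mk_of_subset hsub).trans_lt ?_
  rw [card_iUnion_lt_iff_forall_of_isRegular hκ (by simpa using hχκ)]
  intro x
  refine (mk_bounded_subset_le s _).trans_lt (hinacc _ (max_lt hs ?_) _ (mk_Iio_ord_lt x))
  exact hχ.aleph0_le.trans_lt hχκ

/-- The closure points of a function on a regular uncountable `κ` form a closed unbounded set. -/
theorem meetsClosurePoints_of_stationaryIn (hκ : κ.IsRegular) (hκ₀ : ℵ₀ < κ)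
    {S : Set Ordinal.{u}} (hS : StationaryIn κ S) :
    MeetsClosurePoints {δ : κ.ord.ToType | (δ.toOrd : Ordinal) ∈ S} := by
  intro g
  let C : Set (Set.Iio κ.ord) := {x | ClosedUnder g (ToType.mk x)}
  have hC : IsClub C := by
    refine ⟨fun d hd hd₀ _ a ha ξ hξ => ?_, fun a => ?_⟩
    · obtain ⟨b, hb, hlt⟩ := (lt_isLUB_iff ha).1 (show ToType.mk.symm ξ < a by
        rwa [OrderIso.symm_apply_lt])
      exact (hd hb ξ (by rwa [OrderIso.symm_apply_lt] at hlt)).trans_le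
        (ToType.mk.monotone (ha.1 hb))
    · obtain ⟨G, hG⟩ := exists_bound_below hκ g
      let f : ℕ → κ.ord.ToType := fun n => (fun ξ => max ξ (G ξ))^[n] (ToType.mk a)
      have hfs : ∀ n, f (n + 1) = max (f n) (G (f n)) := fun n =>
        Function.iterate_succ_apply' _ _ _
      let B : Set κ.ord.ToType := {ξ | ∀ n, f n ≤ ξ}
      have hB : B.Nonempty := by
        obtain ⟨ξ, hξ⟩ := exists_forall_lt_of_mk_lt hκ (Set.range f)
          ((Set.countable_range f).le_aleph0.trans_lt hκ₀)
        exact ⟨ξ, fun n => (hξ _ ⟨n, rfl⟩).le⟩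
      refine ⟨ToType.mk.symm (wellFounded_lt.min B hB), ?_, ?_⟩
      · intro ξ hξ
        rw [OrderIso.apply_symm_apply] at hξ ⊢
        obtain ⟨n, hn⟩ : ∃ n, ξ < f n := by
          by_contra! hc
          exact wellFounded_lt.not_lt_min B (x := ξ) hc hξ
        refine (hG _ _ hn.le).trans_le (le_trans ?_ (wellFounded_lt.min_mem B hB (n + 1)))
        rw [hfs]
        exact le_max_right _ _
      · rw [← OrderIso.symm_apply_apply ToType.mk a]
        exact ToType.mk.symm.monotone (wellFounded_lt.min_mem B hB 0)
  obtain ⟨x, hxS, hxC⟩ := hS hC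
  refine ⟨ToType.mk x, ?_, hxC⟩
  simpa [ToType.toOrd] using hxS

end Regular

/-! ### Layering along a filtration -/

section Filtration

variable {κ : Cardinal.{u}}

/-- A poset of size less than `κ` is its own regular suborder. -/
theorem stationarilyLayered_of_mk_lt {P : Type u} [Preorder P] (hP : #P < κ) :
    StationarilyLayered κ P := by
  refine ⟨fun _ hx => hx.1, fun C hC => ?_⟩
  obtain ⟨y, hy, hsub⟩ := hC.2.1 Set.univ (by simpa using hP)
  obtain rfl : y = Set.univ := Set.univ_subset_iff.1 hsub
  refine ⟨_, ⟨by simpa using hP, fun _ _ _ _ h => h, fun p => ⟨p, trivial, fun r _ hr => ?_⟩⟩, hy⟩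
  exact ⟨r, trivial, le_rfl, hr⟩

/-- A poset filtered by an increasing `κ`-sequence of small suborders is stationarily layered as
soon as, for stationarily many `δ`, the filtration is continuous at `δ` and its `δ`-th term is a
regular suborder. Indeed, a club of `𝒫_κ(P)` contains an increasing sequence interleaved with the
filtration, whose union up to a suitable `δ` is the `δ`-th term of the filtration. -/
theorem stationarilyLayered_of_filtration (hκ : κ.IsRegular) {P : Type u} [Preorder P]
    (Q : κ.ord.ToType → Set P) (hmono : Monotone Q) (hcard : ∀ ξ, #(Q ξ) < κ)
    (hcov : ∀ p, ∃ ξ, p ∈ Q ξ) {S : Set κ.ord.ToType} (hS : MeetsClosurePoints S)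
    (hpos : ∀ δ ∈ S, ∃ ξ, ξ < δ) (hcont : ∀ δ ∈ S, ∀ p ∈ Q δ, ∃ ξ < δ, p ∈ Q ξ)
    (hreg : ∀ δ ∈ S, IsRegularSuborder (Q δ)) :
    StationarilyLayered κ P := by
  refine ⟨fun _ hx => hx.1, fun C hC => ?_⟩
  have step : ∀ (ξ : κ.ord.ToType) (h : Set.Iio ξ → C), ∃ y : C, Q ξ ∪ ⋃ ζ, (h ζ).1 ⊆ y.1 := by
    intro ξ h
    obtain ⟨y, hy, hsub⟩ := hC.2.1 (Q ξ ∪ ⋃ ζ, (h ζ).1) <| by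
      refine (mk_union_le _ _).trans_lt (add_lt_of_lt hκ.aleph0_le (hcard ξ) ?_)
      rw [card_iUnion_lt_iff_forall_of_isRegular hκ (mk_Iio_ord_lt ξ)]
      exact fun ζ => hC.1 _ (h ζ).2
    exact ⟨⟨y, hy⟩, hsub⟩
  choose F hF using step
  let x : κ.ord.ToType → C := wellFounded_lt.fix fun ξ ih => F ξ fun y => ih y.1 y.2
  have hx : ∀ ξ, Q ξ ∪ ⋃ ζ : Set.Iio ξ, (x ζ.1).1 ⊆ (x ξ).1 := fun ξ => by
    have : x ξ = F ξ fun y => x y.1 := wellFounded_lt.fix_eq _ ξ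
    rw [this]
    exact hF ξ fun y => x y.1
  have hxm : ∀ ζ ξ, ζ ≤ ξ → (x ζ).1 ⊆ (x ξ).1 := fun ζ ξ h => by
    rcases h.eq_or_lt with rfl | h
    · exact subset_rfl
    · exact (Set.subset_iUnion (fun ζ : Set.Iio ξ => (x ζ.1).1) ⟨ζ, h⟩).trans
        (Set.subset_union_right.trans (hx ξ))
  have hg : ∀ ξ, ∃ ζ, (x ξ).1 ⊆ Q ζ := fun ξ => by
    choose f hf using hcov
    obtain ⟨ζ, hζ⟩ := exists_forall_lt_of_mk_lt hκ (f '' (x ξ).1)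
      (mk_image_le.trans_lt (hC.1 _ (x ξ).2))
    exact ⟨ζ, fun p hp => hmono (hζ _ ⟨p, hp, rfl⟩).le (hf p)⟩
  choose g hg using hg
  obtain ⟨δ, hδ, hgδ⟩ := hS g
  refine ⟨Q δ, ⟨hcard δ, hreg δ hδ⟩, ?_⟩
  have hU : ⋃₀ ((fun ξ => (x ξ).1) '' Set.Iio δ) = Q δ := by
    apply subset_antisymm
    · rintro p ⟨_, ⟨ξ, hξ, rfl⟩, hp⟩
      exact hmono (hgδ ξ hξ).le (hg ξ hp)
    · intro p hp
      obtain ⟨ξ, hξ, hpξ⟩ := hcont δ hδ p hp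
      exact ⟨_, ⟨ξ, hξ, rfl⟩, hx ξ (Or.inl hpξ)⟩
  rw [← hU]
  refine hC.2.2 _ ?_ ?_ ?_ (mk_image_le.trans_lt (mk_Iio_ord_lt δ))
  · rintro _ ⟨ξ, -, rfl⟩
    exact (x ξ).2
  · obtain ⟨ξ, hξ⟩ := hpos δ hδ
    exact ⟨_, ξ, hξ, rfl⟩
  · rintro _ ⟨ξ, -, rfl⟩ _ ⟨ζ, -, rfl⟩ -
    exact (le_total ξ ζ).imp (hxm _ _) (hxm _ _)

end Filtration

/-! ### Posets of small independent sets -/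

section Independent

/-- The poset of `R`-independent subsets of `X` of size less than `χ`, ordered by reverse
inclusion. -/
def IndepPoset (χ : Cardinal.{u}) {A : Type u} (R : A → A → Prop) (X : Set A) : Type u :=
  {x : Set A // x ⊆ X ∧ #x < χ ∧ x.Pairwise fun a b => ¬ R a b}

variable {χ : Cardinal.{u}} {A : Type u} {R : A → A → Prop} {X : Set A}

instance : PartialOrder (IndepPoset χ R X) :=
  PartialOrder.lift (fun x => OrderDual.toDual x.1) fun _ _ h => Subtype.ext h

/-- The union of two compatible conditions. -/
def IndepPoset.union (hχ : ℵ₀ ≤ χ) (p q : IndepPoset χ R X)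
    (h : (p.1 ∪ q.1).Pairwise fun a b => ¬ R a b) : IndepPoset χ R X :=
  ⟨p.1 ∪ q.1, Set.union_subset p.2.1 q.2.1,
    (mk_union_le _ _).trans_lt (add_lt_of_lt hχ p.2.2.1 q.2.2.1), h⟩

/-- The condition with a single element. -/
def IndepPoset.single (hχ : ℵ₀ ≤ χ) (a : A) (ha : a ∈ X) : IndepPoset χ R X :=
  ⟨{a}, Set.singleton_subset_iff.2 ha, (by simpa using one_lt_aleph0.trans_le hχ),
    Set.pairwise_singleton _ _⟩

theorem IndepPoset.wellMet (hχ : ℵ₀ ≤ χ) : WellMet (IndepPoset χ R X) := by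
  rintro p q ⟨r, -, hrp, hrq⟩
  refine ⟨p.union hχ q (r.2.2.2.mono (Set.union_subset hrp hrq)), ?_, ?_⟩
  · rintro s (rfl | rfl)
    · exact Set.subset_union_left
    · exact Set.subset_union_right
  · intro s hs
    exact Set.union_subset (hs (Or.inl rfl)) (hs (Or.inr rfl))

theorem IndepPoset.directedClosedGLB (hχ : χ.IsRegular) :
    DirectedClosedGLB χ (IndepPoset χ R X) := by
  intro D hD hDχ
  refine ⟨⟨⋃ p : D, p.1.1, Set.iUnion_subset fun p => p.1.2.1, ?_, ?_⟩, ?_, ?_⟩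
  · rw [card_iUnion_lt_iff_forall_of_isRegular hχ hDχ]
    exact fun p => p.1.2.2.1
  · intro a ha b hb hab
    obtain ⟨p, hp⟩ := Set.mem_iUnion.1 ha
    obtain ⟨q, hq⟩ := Set.mem_iUnion.1 hb
    obtain ⟨r, -, hpr, hqr⟩ := hD p.1 p.2 q.1 q.2
    exact r.2.2.2 (hpr hp) (hqr hq) hab
  · intro p hp
    exact Set.subset_iUnion (fun p : D => p.1.1) ⟨p, hp⟩
  · intro s hs
    exact Set.iUnion_subset fun p => hs p.2

end Independent

/-! ### Systems of level sets and their graphs -/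

/-- `s` is bounded strictly below `δ` within the elements smaller than `δ`. -/
def BoundedAt {V : Type u} [LinearOrder V] (s : Set V) (δ : V) : Prop :=
  ∃ ξ < δ, ∀ α ∈ s, α < δ → α ≤ ξ

/-- The properties of the level sets `D i β = {α < β | c(α, β) ≤ i}` of a coloring that is
subadditive of the second kind and strongly unbounded. Closedness is only demanded at the points of
a set `Γ` of successor points, but there it includes the closure point `sup (D i β)` itself. -/
structure IsLevelSystem {Θ V : Type u} [LinearOrder Θ] [LinearOrder V] (D : Θ → V → Set V)
    (Γ : Set V) : Prop where
  lt : ∀ {i α β}, α ∈ D i β → α < β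
  mono : ∀ {i j β}, i ≤ j → D i β ⊆ D j β
  cover : ∀ {α β}, α < β → ∃ i, α ∈ D i β
  clique : ∀ {i α β γ}, α ∈ D i γ → β ∈ D i γ → α < β → α ∈ D i β
  closed : ∀ {i β δ}, β ∈ Γ → δ < β → (∃ α, α < δ) → ¬ BoundedAt (D i β) δ → δ ∈ D i β
  exists_notMem : ∀ (i) (X : Set V), #X = #V → ∃ α ∈ X, ∃ β ∈ X, α < β ∧ α ∉ D i β
  exists_pred : ∀ {β}, β ∈ Γ → ∃ γ < β, ∀ x < β, x ≤ γ

section Graph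

variable {Θ V : Type u} (D : Θ → V → Set V)

/-- The disjoint union, over the levels `i`, of the graphs on `V` joining `β` to the points of
`D i β`. -/
def LevelAdj (a b : Θ × V) : Prop :=
  a.1 = b.1 ∧ (a.2 ∈ D a.1 b.2 ∨ b.2 ∈ D a.1 a.2)

/-- The vertex `k` together with its smaller neighbours. -/
def lowerClique (k : Θ × V) : Set (Θ × V) :=
  {a | a.1 = k.1 ∧ (a.2 = k.2 ∨ a.2 ∈ D k.1 k.2)}

variable {D}

theorem LevelAdj.symm {a b : Θ × V} (h : LevelAdj D a b) : LevelAdj D b a :=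
  ⟨h.1.symm, h.1 ▸ h.2.symm⟩

variable {Γ : Set V} [LinearOrder Θ] [LinearOrder V]

theorem IsLevelSystem.snd_le_of_mem_lowerClique (hD : IsLevelSystem D Γ) {k a : Θ × V}
    (h : a ∈ lowerClique D k) : a.2 ≤ k.2 := by
  rcases h.2 with h | h
  · exact h.le
  · exact (hD.lt h).le

theorem IsLevelSystem.levelAdj_of_mem_lowerClique (hD : IsLevelSystem D Γ) {k a b : Θ × V}
    (ha : a ∈ lowerClique D k) (hb : b ∈ lowerClique D k) (hab : a ≠ b) : LevelAdj D a b := by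
  obtain ⟨i, η⟩ := k
  obtain ⟨i₁, α⟩ := a
  obtain ⟨i₂, β⟩ := b
  obtain ⟨rfl : i₁ = i, ha⟩ := ha
  obtain ⟨rfl : i₂ = i₁, hb⟩ := hb
  have hne : α ≠ β := fun h => hab (by rw [h])
  refine ⟨rfl, ?_⟩
  rcases ha with rfl | ha <;> rcases hb with rfl | hb
  · exact absurd rfl hne
  · exact Or.inr hb
  · exact Or.inl ha
  · rcases hne.lt_or_gt with h | h
    · exact Or.inl (hD.clique ha hb h)
    · exact Or.inr (hD.clique hb ha h)

/-- If `D i β` is bounded at `δ` and has points below `δ`, then it has a largest point below `δ`: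
the supremum of these points belongs to `D i β`, by closedness. -/
theorem IsLevelSystem.exists_isGreatest [WellFoundedLT V] (hD : IsLevelSystem D Γ) {i : Θ} {β δ : V}
    (hβ : β ∈ Γ) (hδ : δ ≤ β) (hb : BoundedAt (D i β) δ) {α : V} (hα : α ∈ D i β) (hαδ : α < δ) :
    ∃ η, IsGreatest {α ∈ D i β | α < δ} η := by
  let B : Set V := {ξ | ξ < δ ∧ ∀ α ∈ D i β, α < δ → α ≤ ξ}
  have hB : B.Nonempty := hb
  obtain ⟨hσ, hub⟩ := wellFounded_lt.min_mem B hB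
  set σ := wellFounded_lt.min B hB
  have hσD : σ ∈ D i β := by
    by_contra hn
    have hlt : ∀ α ∈ D i β, α < δ → α < σ := fun α h h' =>
      (hub α h h').lt_of_ne fun h'' => hn (h'' ▸ h)
    refine hn (hD.closed hβ (hσ.trans_le hδ) ⟨α, hlt α hα hαδ⟩ ?_)
    rintro ⟨ξ, hξ, hle⟩
    exact wellFounded_lt.not_lt_min B (x := ξ)
      ⟨hξ.trans hσ, fun α h h' => hle α h (hlt α h h')⟩ hξ
  exact ⟨σ, ⟨hσD, hσ⟩, fun α h => hub α h.1 h.2⟩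

end Graph

/-! ### Reductions of conditions -/

section Reduction

variable {κ χ : Cardinal.{u}} {Θ : Type u} {D : Θ → κ.ord.ToType → Set κ.ord.ToType}

/-- The configurations to be reflected below `δ`: a small set `b` of vertices that is independent
over `u`, and such that over `u ∪ b` no vertex from the cliques coded by `h` can be added. -/
def IsBlocking (χ : Cardinal.{u}) (D : Θ → κ.ord.ToType → Set κ.ord.ToType)
    (X u h b : Set (Θ × κ.ord.ToType)) : Prop :=
  b ⊆ X ∧ #b < χ ∧ (u ∪ b).Pairwise (fun a b => ¬ LevelAdj D a b) ∧
    ∀ k ∈ h, ∀ a ∈ lowerClique D k, a ∈ X →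
      (insert a (u ∪ b)).Pairwise (fun a b => ¬ LevelAdj D a b) → a ∈ u

/-- A function whose closure points of cofinality at least `χ` reflect blocking configurations. -/
theorem exists_reflecting_function (hκ : κ.IsRegular) (hχ : χ.IsRegular) (hχκ : χ < κ)
    (hinacc : LtInaccessible κ χ) (hΘ : #Θ < κ) (X : Set (Θ × κ.ord.ToType)) :
    ∃ g : κ.ord.ToType → κ.ord.ToType, ∀ δ, HasCofGE χ δ → ClosedUnder g δ →
      ∀ u h : Set (Θ × κ.ord.ToType), #u < χ → #h < χ → (∀ a ∈ u, a.2 < δ) → (∀ a ∈ h, a.2 < δ) →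
        (∃ b, IsBlocking χ D X u h b) → ∃ b, IsBlocking χ D X u h b ∧ ∀ a ∈ b, a.2 < δ := by
  have : ∀ u h : Set (Θ × κ.ord.ToType), ∃ b : Set (Θ × κ.ord.ToType), #b < χ ∧
      ((∃ b, IsBlocking χ D X u h b) → IsBlocking χ D X u h b) := fun u h => by
    by_cases hb : ∃ b, IsBlocking χ D X u h b
    · obtain ⟨b, hb⟩ := hb
      exact ⟨b, hb.2.1, fun _ => hb⟩
    · exact ⟨∅, by simpa using hχ.pos, fun h => absurd h hb⟩
  choose b hbχ hb using this
  let W : κ.ord.ToType → Set (Set (Θ × κ.ord.ToType)) := fun ξ =>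
    {t | t ⊆ Set.univ ×ˢ Set.Iio ξ ∧ #t < χ}
  have hW : ∀ ξ, #(W ξ) < κ := fun ξ => by
    refine mk_small_subsets_lt hκ hχ hχκ hinacc _ ?_
    rw [mk_setProd, mk_univ]
    exact mul_lt_of_lt hκ.aleph0_le hΘ (mk_Iio_ord_lt ξ)
  have : ∀ ξ, ∃ ζ, ∀ u ∈ W ξ, ∀ h ∈ W ξ, ∀ a ∈ b u h, a.2 < ζ := fun ξ => by
    obtain ⟨ζ, hζ⟩ := exists_forall_lt_of_mk_lt hκ
      (Prod.snd '' ⋃ u : W ξ, ⋃ h : W ξ, b u.1 h.1) <| by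
        refine mk_image_le.trans_lt ?_
        rw [card_iUnion_lt_iff_forall_of_isRegular hκ (hW ξ)]
        intro u
        rw [card_iUnion_lt_iff_forall_of_isRegular hκ (hW ξ)]
        exact fun h => (hbχ _ _).trans hχκ
    refine ⟨ζ, fun u hu h hh a ha => hζ _ ⟨a, ?_, rfl⟩⟩
    exact Set.mem_iUnion.2 ⟨⟨u, hu⟩, Set.mem_iUnion.2 ⟨⟨h, hh⟩, ha⟩⟩
  choose g hg using this
  refine ⟨g, fun δ hδ hgδ u h hu hh huδ hhδ hex => ⟨b u h, hb u h hex, fun a ha => ?_⟩⟩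
  obtain ⟨ξ, hξδ, hξ⟩ := hδ (Prod.snd '' (u ∪ h))
    (by rintro _ ⟨a, ha | ha, rfl⟩; exacts [huδ a ha, hhδ a ha])
    (mk_image_le.trans_lt ((mk_union_le _ _).trans_lt (add_lt_of_lt hχ.aleph0_le hu hh)))
  refine (hg ξ u ⟨fun a ha => ⟨trivial, hξ _ ⟨a, Or.inl ha, rfl⟩⟩, hu⟩ h
    ⟨fun a ha => ⟨trivial, hξ _ ⟨a, Or.inr ha, rfl⟩⟩, hh⟩ a ha).trans (hgδ ξ hξδ)

variable [LinearOrder Θ] {Γ : Set κ.ord.ToType}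

/-- A maximal set of vertices from the cliques coded by `h` that is independent over `p`. Being
independent, it has at most one vertex in each clique. -/
theorem IsLevelSystem.exists_maximal_extension (hD : IsLevelSystem D Γ)
    (X h p : Set (Θ × κ.ord.ToType)) (hp : p.Pairwise fun a b => ¬ LevelAdj D a b) :
    ∃ w ⊆ X, #w ≤ #h ∧ (∀ a ∈ w, ∃ k ∈ h, a ∈ lowerClique D k) ∧
      (w ∪ p).Pairwise (fun a b => ¬ LevelAdj D a b) ∧
      ∀ k ∈ h, ∀ a ∈ lowerClique D k, a ∈ X →
        (insert a (w ∪ p)).Pairwise (fun a b => ¬ LevelAdj D a b) → a ∈ w := by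
  let Z : Set (Set (Θ × κ.ord.ToType)) := {w | w ⊆ X ∧ (∀ a ∈ w, ∃ k ∈ h, a ∈ lowerClique D k) ∧
    (w ∪ p).Pairwise (fun a b => ¬ LevelAdj D a b)}
  obtain ⟨w, hw⟩ := zorn_subset Z <| by
    intro C hC hchain
    refine ⟨⋃₀ C, ⟨Set.sUnion_subset fun w hw => (hC hw).1, ?_, ?_⟩, fun w hw =>
      Set.subset_sUnion_of_mem hw⟩
    · rintro a ⟨w, hw, ha⟩
      exact (hC hw).2.1 a ha
    · rintro a (⟨w, hw, ha⟩ | ha) b (⟨w', hw', hb⟩ | hb) hab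
      · rcases hchain.total hw hw' with h | h
        · exact (hC hw').2.2 (Or.inl (h ha)) (Or.inl hb) hab
        · exact (hC hw).2.2 (Or.inl ha) (Or.inl (h hb)) hab
      · exact (hC hw).2.2 (Or.inl ha) (Or.inr hb) hab
      · exact (hC hw').2.2 (Or.inr ha) (Or.inl hb) hab
      · exact hp ha hb hab
  obtain ⟨hwX, hwK, hwp⟩ := hw.prop
  refine ⟨w, hwX, ?_, hwK, hwp, fun k hk a hak haX hind => ?_⟩
  · choose f hfh hf using fun a : w => hwK a.1 a.2
    refine mk_le_of_injective (f := fun a => (⟨f a, hfh a⟩ : h)) fun a b hab => ?_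
    have hab : f a = f b := congrArg Subtype.val hab
    by_contra hne
    have hne : a.1 ≠ b.1 := fun h => hne (Subtype.ext h)
    exact hwp (Or.inl a.2) (Or.inl b.2) hne
      (hD.levelAdj_of_mem_lowerClique (hf a) (hab ▸ hf b) hne)
  · refine hw.le_of_ge (y := insert a w) ⟨Set.insert_subset haX hwX, ?_, ?_⟩
      (Set.subset_insert a w) (Set.mem_insert a w)
    · rintro x (rfl | hx)
      exacts [⟨k, hk, hak⟩, hwK x hx]
    · rwa [Set.insert_union]

/-- Reductions below `δ`. Given a condition `p`, let `h` code the cliques, each consisting of the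
largest neighbour below `δ` of a vertex of `p` above `δ` and its smaller neighbours. Extend the part
of `p` below `δ` by a maximal independent set of vertices from these cliques, and reflect the
part of `p` above `δ`. Every neighbour below `δ` of a vertex of `p` is then blocked. -/
theorem IsLevelSystem.exists_reduction (hD : IsLevelSystem D Γ) (hκ : κ.IsRegular)
    (hχ : χ.IsRegular) (hχκ : χ < κ) (hinacc : LtInaccessible κ χ) (hΘ : #Θ < κ)
    (X : Set (Θ × κ.ord.ToType)) (hX : ∀ a ∈ X, a.2 ∈ Γ) :
    ∃ g : κ.ord.ToType → κ.ord.ToType, ∀ δ, HasCofGE χ δ → ClosedUnder g δ →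
      (∀ a ∈ X, δ ≤ a.2 → BoundedAt (D a.1 a.2) δ) →
      ∀ p : IndepPoset χ (LevelAdj D) X, ∃ q : IndepPoset χ (LevelAdj D) X,
        (∀ a ∈ q.1, a.2 < δ) ∧ ∀ r ≤ q, (∀ a ∈ r.1, a.2 < δ) →
          (r.1 ∪ p.1).Pairwise fun a b => ¬ LevelAdj D a b := by
  obtain ⟨g, hg⟩ := exists_reflecting_function (D := D) hκ hχ hχκ hinacc hΘ X
  refine ⟨g, fun δ hδ hgδ hbdd p => ?_⟩
  obtain ⟨p, hpX, hpχ, hp⟩ := p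
  have : ∀ β : Θ × κ.ord.ToType, ∃ η,
      (∃ η, IsGreatest {α ∈ D β.1 β.2 | α < δ} η) → IsGreatest {α ∈ D β.1 β.2 | α < δ} η :=
    fun β => by
      by_cases h : ∃ η, IsGreatest {α ∈ D β.1 β.2 | α < δ} η
      · obtain ⟨η, h⟩ := h
        exact ⟨η, fun _ => h⟩
      · exact ⟨β.2, fun h' => absurd h' h⟩
  choose f hf using this
  let h : Set (Θ × κ.ord.ToType) := (fun β => (β.1, f β)) ''
    {β ∈ p | ∃ η, IsGreatest {α ∈ D β.1 β.2 | α < δ} η}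
  have hhχ : #h < χ := (mk_image_le.trans (mk_le_mk_of_subset (Set.sep_subset _ _))).trans_lt hpχ
  have hhδ : ∀ k ∈ h, k.2 < δ := by
    rintro _ ⟨β, ⟨-, hβ⟩, rfl⟩
    exact (hf β hβ).1.2
  obtain ⟨w, hwX, hwh, hwK, hwp, hwmax⟩ := hD.exists_maximal_extension X h p hp
  let u : Set (Θ × κ.ord.ToType) := w ∪ {a ∈ p | a.2 < δ}
  have huw : u ⊆ w ∪ p := Set.union_subset_union_right _ (Set.sep_subset _ _)
  have huX : u ⊆ X := huw.trans (Set.union_subset hwX hpX)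
  have huδ : ∀ a ∈ u, a.2 < δ := by
    rintro a (ha | ha)
    · obtain ⟨k, hk, hak⟩ := hwK a ha
      exact (hD.snd_le_of_mem_lowerClique hak).trans_lt (hhδ k hk)
    · exact ha.2
  have huχ : #u < χ := (mk_union_le _ _).trans_lt <| add_lt_of_lt hχ.aleph0_le
    (hwh.trans_lt hhχ) ((mk_le_mk_of_subset (Set.sep_subset _ _)).trans_lt hpχ)
  have hub : u ∪ {a ∈ p | δ ≤ a.2} = w ∪ p := by
    ext a
    have := lt_or_ge a.2 δ
    simp only [u, Set.mem_union, Set.mem_ofPred_eq]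
    tauto
  obtain ⟨b, ⟨hbX, hbχ, hbp, hblock⟩, hbδ⟩ := hg δ hδ hgδ u h huχ hhχ huδ hhδ
    ⟨{a ∈ p | δ ≤ a.2}, (Set.sep_subset _ _).trans hpX,
      (mk_le_mk_of_subset (Set.sep_subset _ _)).trans_lt hpχ, by rwa [hub], fun k hk a ha haX hi =>
        Or.inl (hwmax k hk a ha haX (by rwa [hub] at hi))⟩
  refine ⟨⟨u ∪ b, Set.union_subset huX hbX, (mk_union_le _ _).trans_lt
    (add_lt_of_lt hχ.aleph0_le huχ hbχ), hbp⟩, ?_, fun r hr hrδ => ?_⟩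
  · rintro a (ha | ha)
    exacts [huδ a ha, hbδ a ha]
  · have hr : u ∪ b ⊆ r.1 := hr
    have key : ∀ a ∈ r.1, ∀ β ∈ p, a ≠ β → ¬ LevelAdj D a β := by
      intro a ha β hβ hne hadj
      rcases lt_or_ge β.2 δ with hβδ | hβδ
      · exact r.2.2.2 ha (hr (Or.inl (Or.inr ⟨hβ, hβδ⟩))) hne hadj
      -- `a` is a neighbour below `δ` of the vertex `β` above `δ`
      have haβ : a.2 ∈ D β.1 β.2 := by
        rcases hadj.2 with h | h
        · exact hadj.1 ▸ h
        · exact absurd (hD.lt h) ((hrδ a ha).trans_le hβδ).not_gt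
      have hmax := hf β (hD.exists_isGreatest (hX _ (hpX hβ)) hβδ (hbdd β (hpX hβ) hβδ) haβ
        (hrδ a ha))
      have hau : a ∈ u := by
        refine hblock (β.1, f β) ⟨β, ⟨hβ, _, hmax⟩, rfl⟩ a ⟨hadj.1, ?_⟩ (r.2.1 ha)
          (r.2.2.2.mono (Set.insert_subset ha hr))
        exact (hmax.2 ⟨haβ, hrδ a ha⟩).eq_or_lt.imp_right fun h => hD.clique haβ hmax.1.1 h
      exact hwp (huw hau) (Or.inr hβ) hne hadj
    rintro a (ha | ha) β (hβ | hβ) hne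
    · exact r.2.2.2 ha hβ hne
    · exact key a ha β hβ hne
    · exact fun hadj => key β hβ a ha hne.symm hadj.symm
    · exact hp ha hβ hne

/-- Products of fewer than `χ` posets of small independent sets are stationarily layered, if
stationarily many `δ` bound all the relevant level sets. -/
theorem IsLevelSystem.stationarilyLayered_pi (hD : IsLevelSystem D Γ) (hκ : κ.IsRegular)
    (hχ : χ.IsRegular) (hχκ : χ < κ) (hinacc : LtInaccessible κ χ) (hΘ : #Θ < κ)
    {T : Type u} (hT : #T < χ) (X : T → Set (Θ × κ.ord.ToType)) (hX : ∀ t, ∀ a ∈ X t, a.2 ∈ Γ)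
    {S : Set κ.ord.ToType} (hS : MeetsClosurePoints S) (hSχ : ∀ δ ∈ S, HasCofGE χ δ)
    (hbdd : ∀ δ ∈ S, ∀ t, ∀ a ∈ X t, δ ≤ a.2 → BoundedAt (D a.1 a.2) δ) :
    StationarilyLayered κ (∀ t, IndepPoset χ (LevelAdj D) (X t)) := by
  choose g hg using fun t => hD.exists_reduction hκ hχ hχκ hinacc hΘ (X t) (hX t)
  choose G hG using fun ξ => exists_forall_lt_of_mk_index_lt hκ (hT.trans hχκ) fun t => g t ξ
  let supp : (∀ t, IndepPoset χ (LevelAdj D) (X t)) → Set (T × (Θ × κ.ord.ToType)) :=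
    fun p => {a | a.2 ∈ (p a.1).1}
  have hsupp : ∀ p, #(supp p) < χ := fun p => by
    have : supp p = ⋃ t, Prod.mk t '' (p t).1 := by
      ext ⟨t, a⟩
      simp [supp]
    rw [this, card_iUnion_lt_iff_forall_of_isRegular hχ hT]
    exact fun t => mk_image_le.trans_lt (p t).2.2.1
  have hinj : Function.Injective supp := fun p q h => by
    funext t
    refine Subtype.ext (Set.ext fun a => ?_)
    exact Set.ext_iff.1 h (t, a)
  refine stationarilyLayered_of_filtration hκ
    (fun δ => {p | ∀ t, ∀ a ∈ (p t).1, a.2 < δ}) ?_ ?_ ?_ (hS.inter_closedUnder G) ?_ ?_ ?_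
  · exact fun δ ε h p hp t a ha => (hp t a ha).trans_le h
  · intro δ
    have hs : #(Set.univ ×ˢ (Set.univ ×ˢ Set.Iio δ) : Set (T × (Θ × κ.ord.ToType))) < κ := by
      rw [mk_setProd, mk_setProd, mk_univ, mk_univ]
      exact mul_lt_of_lt hκ.aleph0_le (hT.trans hχκ)
        (mul_lt_of_lt hκ.aleph0_le hΘ (mk_Iio_ord_lt δ))
    refine lt_of_le_of_lt ?_ (mk_small_subsets_lt hκ hχ hχκ hinacc _ hs)
    refine mk_le_of_injective (f := fun p => ⟨supp p.1, fun a ha =>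
      ⟨trivial, trivial, p.2 a.1 a.2 ha⟩, hsupp p.1⟩) fun p q h => ?_
    exact Subtype.ext (hinj (congrArg Subtype.val h))
  · intro p
    obtain ⟨ξ, hξ⟩ := exists_forall_lt_of_mk_lt hκ ((fun a => a.2.2) '' supp p)
      (mk_image_le.trans_lt ((hsupp p).trans hχκ))
    exact ⟨ξ, fun t a ha => hξ _ ⟨(t, a), ha, rfl⟩⟩
  · rintro δ ⟨hδ, -⟩
    obtain ⟨ξ, hξ, -⟩ := hSχ δ hδ ∅ (by simp) (by simpa using hχ.pos)
    exact ⟨ξ, hξ⟩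
  · rintro δ ⟨hδ, -⟩ p hp
    obtain ⟨ξ, hξδ, hξ⟩ := hSχ δ hδ ((fun a => a.2.2) '' supp p)
      (by rintro _ ⟨a, ha, rfl⟩; exact hp a.1 a.2 ha) (mk_image_le.trans_lt (hsupp p))
    exact ⟨ξ, hξδ, fun t a ha => hξ _ ⟨(t, a), ha, rfl⟩⟩
  · rintro δ ⟨hδ, hGδ⟩
    refine ⟨fun q hq r hr ⟨s, _, hsq, hsr⟩ => ?_, fun p => ?_⟩
    · refine ⟨fun t => (q t).union hχ.aleph0_le (r t)
        ((s t).2.2.2.mono (Set.union_subset (hsq t) (hsr t))), ?_, fun t => ?_, fun t => ?_⟩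
      · rintro t a (ha | ha)
        exacts [hq t a ha, hr t a ha]
      · exact Set.subset_union_left
      · exact Set.subset_union_right
    · choose q hqδ hq using fun t => hg t δ (hSχ δ hδ)
        (fun ξ hξ => (hG ξ t).trans (hGδ ξ hξ)) (hbdd δ hδ t) (p t)
      refine ⟨q, hqδ, fun r hr hrq => ⟨fun t => (r t).union hχ.aleph0_le (p t)
        (hq t (r t) (hrq t) (hr t)), trivial, fun t => ?_, fun t => ?_⟩⟩
      · exact Set.subset_union_left
      · exact Set.subset_union_right

end Reduction

/-! ### Separating stationary sets -/

section Separation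

variable {κ χ : Cardinal.{u}} {Θ : Type u} [LinearOrder Θ]
  {D : Θ → κ.ord.ToType → Set κ.ord.ToType} {Γ : Set κ.ord.ToType}

theorem HasCofGE.exists_lt {V : Type u} [LT V] {δ : V} (hδ : HasCofGE χ δ) (hχ : 0 < χ) :
    ∃ ξ, ξ < δ := by
  obtain ⟨ξ, hξ, -⟩ := hδ ∅ (by simp) (by simpa using hχ)
  exact ⟨ξ, hξ⟩

/-- The case `δ = β` is excluded because the points of `Γ` are successors. -/
theorem IsLevelSystem.mem_of_not_boundedAt (hD : IsLevelSystem D Γ) (hχ : χ.IsRegular) {i : Θ}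
    {β δ : κ.ord.ToType} (hβ : β ∈ Γ) (hδ : HasCofGE χ δ) (hδβ : δ ≤ β)
    (h : ¬ BoundedAt (D i β) δ) : δ ∈ D i β := by
  refine hD.closed hβ (hδβ.lt_of_ne ?_) (hδ.exists_lt hχ.pos) h
  rintro rfl
  obtain ⟨γ, hγ, hmax⟩ := hD.exists_pred hβ
  obtain ⟨ξ, hξ, hγξ⟩ := hδ {γ} (by simpa using hγ)
    (by simpa using one_lt_aleph0.trans_le hχ.aleph0_le)
  exact (hγξ γ rfl).not_ge (hmax ξ hξ)

/-- For each level there are two stationary sets such that every level set at a point of `Γ` is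
bounded at all points of one of them. If stationarily many `δ` satisfy that `D i δ` is bounded
in `δ`, these `δ` work for every level set. Otherwise `κ` many `v` belong to `D i δ` for stationarily
many `δ`, and two non-adjacent such `v` yield stationary sets with no edges between them, whereas
the points of a level set are pairwise adjacent. -/
theorem IsLevelSystem.exists_stationary_pair (hD : IsLevelSystem D Γ) (hκ : κ.IsRegular)
    (hχ : χ.IsRegular) (hχκ : χ < κ) (i : Θ) :
    ∃ S : Bool → Set κ.ord.ToType, (∀ b, MeetsClosurePoints (S b)) ∧
      (∀ b, ∀ δ ∈ S b, HasCofGE χ δ) ∧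
      ∀ β ∈ Γ, ∃ b, ∀ δ ∈ S b, δ ≤ β → BoundedAt (D i β) δ := by
  by_cases hA : MeetsClosurePoints {δ | HasCofGE χ δ ∧ BoundedAt (D i δ) δ}
  · refine ⟨fun _ => _, fun _ => hA, fun _ δ hδ => hδ.1, fun β hβ => ⟨true, fun δ hδ hδβ => ?_⟩⟩
    by_contra hn
    have hmem := hD.mem_of_not_boundedAt hχ hβ hδ.1 hδβ hn
    obtain ⟨ξ, hξ, hle⟩ := hδ.2
    exact hn ⟨ξ, hξ, fun α hα hαδ => hle α (hD.clique hα hmem hαδ) hαδ⟩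
  · obtain ⟨g, hg⟩ : ∃ g : κ.ord.ToType → κ.ord.ToType, ∀ δ, HasCofGE χ δ → ClosedUnder g δ →
        ¬ BoundedAt (D i δ) δ := by
      unfold MeetsClosurePoints at hA
      push Not at hA
      obtain ⟨g, hg⟩ := hA
      exact ⟨g, fun δ hδ hgδ hb => hg δ ⟨hδ, hb⟩ hgδ⟩
    let N : κ.ord.ToType → Set κ.ord.ToType := fun v => {δ | HasCofGE χ δ ∧ v ∈ D i δ}
    let W : Set κ.ord.ToType := {v | MeetsClosurePoints (N v)}
    have hW : #W = #κ.ord.ToType := by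
      by_contra hne
      have hlt : #W < κ := by simpa using (mk_set_le W).lt_of_ne hne
      obtain ⟨ε, hε⟩ := exists_forall_lt_of_mk_lt hκ W hlt
      obtain ⟨G, hG⟩ := exists_diagonal_closure hκ (I := Set.Ici ε) N
        fun v hv hst => (hε v hst).not_ge hv
      obtain ⟨δ, hδ, hcl⟩ := meetsClosurePoints_hasCofGE hκ hχ hχκ
        fun ξ => max (max (g ξ) (G ξ)) ε
      obtain ⟨ξ₀, hξ₀⟩ := hδ.exists_lt hχ.pos
      have hεδ : ε < δ := (le_max_right _ _).trans_lt (hcl ξ₀ hξ₀)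
      refine hg δ hδ (fun ξ hξ => ((le_max_left _ _).trans (le_max_left _ _)).trans_lt (hcl ξ hξ))
        ⟨ε, hεδ, fun α hα hαδ => ?_⟩
      by_contra! hεα
      exact hG δ (fun ξ hξ => ((le_max_right _ _).trans (le_max_left _ _)).trans_lt (hcl ξ hξ))
        α hεα.le hαδ ⟨hδ, hα⟩
    obtain ⟨v, hv, w, hw, hvw, hnot⟩ := hD.exists_notMem i W hW
    refine ⟨fun b => bif b then N w else {δ ∈ N v | w < δ}, ?_, ?_, fun β hβ => ?_⟩
    · rintro (_ | _)
      · refine (hv.inter_closedUnder fun _ => w).mono ?_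
        rintro δ ⟨hδ, hcl⟩
        obtain ⟨ξ, hξ⟩ := hδ.1.exists_lt hχ.pos
        exact ⟨hδ, hcl ξ hξ⟩
      · exact hw
    · rintro (_ | _) δ hδ
      exacts [hδ.1.1, hδ.1]
    · by_contra! hcon
      obtain ⟨δ₀, ⟨⟨hδ₀, hv₀⟩, hw₀⟩, hle₀, hn₀⟩ := hcon false
      obtain ⟨δ₁, ⟨hδ₁, hw₁⟩, hle₁, hn₁⟩ := hcon true
      have h₀ := hD.mem_of_not_boundedAt hχ hβ hδ₀ hle₀ hn₀
      have h₁ := hD.mem_of_not_boundedAt hχ hβ hδ₁ hle₁ hn₁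
      rcases lt_trichotomy δ₀ δ₁ with h | rfl | h
      · exact hnot (hD.clique hv₀ (hD.clique hw₁ (hD.clique h₀ h₁ h) hw₀) hvw)
      · exact hnot (hD.clique hv₀ hw₁ hvw)
      · have hwδ := hD.lt hw₁
        exact hnot (hD.clique (hD.clique hv₀ (hD.clique h₁ h₀ h) (hvw.trans hwδ)) hw₁ hvw)

end Separation

/-! ### The level system of a coloring -/

section Coloring

variable {κ θ χ : Cardinal.{u}} {c : Ordinal.{u} → Ordinal.{u} → Ordinal.{u}}

/-- The level sets of `c` on the order `κ`, with the levels below `j` merged into level `j`. -/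
def coloringLevel (c : Ordinal.{u} → Ordinal.{u} → Ordinal.{u}) (j : θ.ord.ToType)
    (i : θ.ord.ToType) (β : κ.ord.ToType) : Set κ.ord.ToType :=
  {α | α < β ∧ c α.toOrd β.toOrd ≤ (max i j).toOrd}

theorem toOrd_lt_toOrd {o : Ordinal.{u}} {a b : o.ToType} :
    (a.toOrd : Ordinal) < b.toOrd ↔ a < b :=
  ToType.mk.symm.lt_iff_lt

theorem toOrd_le_toOrd {o : Ordinal.{u}} {a b : o.ToType} :
    (a.toOrd : Ordinal) ≤ b.toOrd ↔ a ≤ b :=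
  ToType.mk.symm.le_iff_le

theorem exists_toOrd_eq {o a : Ordinal.{u}} (h : a < o) : ∃ x : o.ToType, (x.toOrd : Ordinal) = a :=
  ⟨ToType.mk ⟨a, h⟩, by simp [ToType.toOrd]⟩

theorem hasCofGE_of_le_cof {δ : κ.ord.ToType} (h : χ ≤ (δ.toOrd : Ordinal).cof) :
    HasCofGE χ δ := by
  intro s hs hsχ
  have hcof : χ ≤ Order.cof (Set.Iio δ) := h.trans (Order.cof_Iio δ).ge
  by_contra! hcon
  have hc : IsCofinal (Subtype.val ⁻¹' s : Set (Set.Iio δ)) := fun ξ => by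
    obtain ⟨x, hx, hξx⟩ := hcon ξ.1 ξ.2
    exact ⟨⟨x, hs x hx⟩, hx, hξx⟩
  refine ((hcof.trans (Order.cof_le hc)).trans ?_).not_gt hsχ
  exact mk_preimage_of_injective _ _ Subtype.val_injective

theorem exists_notMem_coloringLevel (hU : WitnessesU κ 2 θ 2 c) (i j : θ.ord.ToType)
    (X : Set κ.ord.ToType) (hX : #X = κ) :
    ∃ α ∈ X, ∃ β ∈ X, α < β ∧ α ∉ coloringLevel c j i β := by
  let f : κ.ord.ToType → Set Ordinal.{u} := fun v => {(v.toOrd : Ordinal)}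
  have hf : Function.Injective f := fun v w h =>
    ToType.mk.symm.injective (Subtype.ext (Set.singleton_injective h))
  obtain ⟨ℬ, hℬ, hcard, hgt⟩ := hU.2 1 (by simp) (f '' X)
    (by
      rintro _ ⟨v, -, rfl⟩
      exact ⟨Set.singleton_subset_iff.2 v.toOrd.2, by simp [f]⟩)
    (by
      rintro _ ⟨v, -, rfl⟩ _ ⟨w, -, rfl⟩ hne
      refine Set.disjoint_singleton.2 fun h => hne ?_
      simp only [f, h])
    (by
      have := mk_image_eq_lift f X hf
      rwa [hX, Cardinal.lift_id'.{u, u + 1}] at this)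
    (max i j).toOrd (max i j).toOrd.2
  obtain ⟨a, b, hab, -⟩ := mk_eq_two_iff.1 (show #ℬ = 2 by simpa using hcard)
  obtain ⟨v, hv, hva⟩ := hℬ a.2
  obtain ⟨w, hw, hwb⟩ := hℬ b.2
  have hne : a.1 ≠ b.1 := fun h => hab (Subtype.ext h)
  have key : ∀ v w : κ.ord.ToType, v < w → f v ∈ ℬ → f w ∈ ℬ → v ∉ coloringLevel c j i w := by
    intro v w hvw hv hw hmem
    have := hgt _ hv _ hw (fun h => hvw.ne (hf h))
      (by rintro _ rfl _ rfl; exact toOrd_lt_toOrd.2 hvw) _ rfl _ rfl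
    exact this.not_ge hmem.2
  have hvw : v ≠ w := by
    rintro rfl
    exact hne (hva.symm.trans hwb)
  have hvB : f v ∈ ℬ := hva ▸ a.2
  have hwB : f w ∈ ℬ := hwb ▸ b.2
  rcases hvw.lt_or_gt with h | h
  · exact ⟨v, hv, w, hw, h, key v w h hvB hwB⟩
  · exact ⟨w, hw, v, hv, h, key w v h hwB hvB⟩

/-- A level set of a closed coloring that contains `γ` is closed at the points up to `γ`. Beyond its
supremum, closedness of the coloring says nothing. -/
theorem mem_coloringLevel_of_not_boundedAt (hclosed : IsClosedColoring κ θ c) {i j : θ.ord.ToType}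
    {β δ γ : κ.ord.ToType} (hγ : γ ∈ coloringLevel c j i β) (hδγ : δ ≤ γ) (hpos : ∃ α, α < δ)
    (h : ¬ BoundedAt (coloringLevel c j i β) δ) : δ ∈ coloringLevel c j i β := by
  obtain ⟨α₀, hα₀⟩ := hpos
  have hbdd : BddAbove (levelSet c (max i j).toOrd β.toOrd ∩ Set.Iio (δ.toOrd : Ordinal)) :=
    ⟨δ.toOrd, fun x hx => le_of_lt hx.2⟩
  refine ⟨hδγ.trans_lt hγ.1, ?_⟩
  refine (hclosed β.toOrd β.toOrd.2 (max i j).toOrd (max i j).toOrd.2.le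
    ⟨⟨?_, ?_, ?_⟩, δ.toOrd.2⟩).2
  · have hb : BddAbove (Order.succ '' levelSet c (max i j).toOrd β.toOrd) := by
      refine ⟨β.toOrd, ?_⟩
      rintro _ ⟨x, hx, rfl⟩
      exact Order.succ_le_of_lt hx.1
    exact (Order.lt_succ_of_le (toOrd_le_toOrd.2 hδγ)).trans_le
      (le_csSup hb ⟨γ.toOrd, ⟨toOrd_lt_toOrd.2 hγ.1, hγ.2⟩, rfl⟩)
  · refine le_antisymm (csSup_le' fun x hx => le_of_lt hx.2) ?_
    by_contra! hlt
    obtain ⟨ξ, hξ⟩ := exists_toOrd_eq (hlt.trans δ.toOrd.2)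
    refine h ⟨ξ, toOrd_lt_toOrd.1 (hξ ▸ hlt), fun α hα hαδ => ?_⟩
    rw [← toOrd_le_toOrd, hξ]
    exact le_csSup hbdd ⟨⟨toOrd_lt_toOrd.2 hα.1, hα.2⟩, toOrd_lt_toOrd.2 hαδ⟩
  · exact bot_le.trans_lt (toOrd_lt_toOrd.2 hα₀)

/-- The level sets of `c` are bounded at the levels of divergence. -/
theorem boundedAt_coloringLevel {δ : κ.ord.ToType}
    (hδ : (δ.toOrd : Ordinal) ∈ divergenceLevels κ θ c) (i j : θ.ord.ToType) (β : κ.ord.ToType) :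
    BoundedAt (coloringLevel c j i β) δ := by
  have hlt := hδ.2 β.toOrd β.toOrd.2 (max i j).toOrd (max i j).toOrd.2
  obtain ⟨ξ, hξ⟩ := exists_toOrd_eq (hlt.trans δ.toOrd.2)
  refine ⟨ξ, toOrd_lt_toOrd.1 (hξ ▸ hlt), fun α hα hαδ => ?_⟩
  rw [← toOrd_le_toOrd, hξ]
  exact le_csSup ⟨δ.toOrd, fun x hx => le_of_lt hx.2⟩
    ⟨⟨toOrd_lt_toOrd.2 hα.1, hα.2⟩, toOrd_lt_toOrd.2 hαδ⟩

/-- A suitable coloring gives rise to a level system. Fix a color `j` that `c` assigns to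
`κ` many pairs of a point and its successor, let `Γ` consist of these successors, and merge the
levels below `j`: the level sets at points of `Γ` then contain the predecessor. -/
theorem exists_isLevelSystem (hκ : κ.IsRegular) (hθκ : θ < κ) (hU : WitnessesU κ 2 θ 2 c)
    (hclosed : IsClosedColoring κ θ c) (hsub : IsSubadditiveSnd κ c) :
    ∃ (j : θ.ord.ToType) (Γ : Set κ.ord.ToType), #Γ = κ ∧
      IsLevelSystem (coloringLevel (κ := κ) c j) Γ := by
  have := Cardinal.noMaxOrder hκ.aleph0_le
  have hcol : ∀ {α β : κ.ord.ToType}, α < β → ∃ i : θ.ord.ToType,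
      (i.toOrd : Ordinal) = c α.toOrd β.toOrd := fun {α β} h =>
    exists_toOrd_eq (hU.1 _ _ (toOrd_lt_toOrd.2 h) β.toOrd.2)
  choose f hf using fun γ : κ.ord.ToType => hcol (Order.lt_succ γ)
  obtain ⟨j, hj⟩ := infinite_pigeonhole_card f κ (by simp) hκ.aleph0_le
    (by simpa [hκ.cof_ord] using hθκ)
  refine ⟨j, Order.succ '' (f ⁻¹' {j}), ?_, ?_, ?_, ?_, ?_, ?_, ?_, ?_⟩
  · rw [mk_image_eq Order.succ_injective]
    exact le_antisymm (by simpa using mk_set_le (f ⁻¹' {j})) hj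
  · exact fun h => h.1
  · exact fun h α hα => ⟨hα.1, hα.2.trans (toOrd_le_toOrd.2 (max_le_max_right j h))⟩
  · intro α β h
    obtain ⟨i, hi⟩ := hcol h
    exact ⟨i, h, hi ▸ toOrd_le_toOrd.2 (le_max_left i j)⟩
  · exact fun {i α β γ} hα hβ h => ⟨h, (hsub _ _ _ (toOrd_lt_toOrd.2 h) (toOrd_lt_toOrd.2 hβ.1)
      γ.toOrd.2).trans (max_le hα.2 hβ.2)⟩
  · rintro i _ δ ⟨γ, rfl, rfl⟩ hδ hpos h
    refine mem_coloringLevel_of_not_boundedAt hclosed (γ := γ) ⟨Order.lt_succ γ, ?_⟩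
      (Order.le_of_lt_succ hδ) hpos h
    exact hf γ ▸ toOrd_le_toOrd.2 (le_max_right i (f γ))
  · exact fun i X hX => exists_notMem_coloringLevel hU i j X (by simpa using hX)
  · rintro _ ⟨γ, -, rfl⟩
    exact ⟨γ, Order.lt_succ γ, fun x hx => Order.le_of_lt_succ hx⟩

end Coloring

/-! ### Antichains in full products -/

section Antichains

variable {κ θ χ : Cardinal.{u}}

/-- The conditions `i ↦ {(i, α)}`, for `α ∈ Γ`, are pairwise incompatible, because any two points
are adjacent in some level. -/
theorem IsLevelSystem.not_chainCondition {Θ : Type u} [LinearOrder Θ]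
    {D : Θ → κ.ord.ToType → Set κ.ord.ToType} {Γ Δ : Set κ.ord.ToType} (hD : IsLevelSystem D Γ)
    (hχ : χ.IsRegular) [Nonempty Θ] (hΔ : #Δ = κ) (X : Θ → Set (Θ × κ.ord.ToType))
    (hX : ∀ i, ∀ α ∈ Δ, (i, α) ∈ X i) :
    ¬ ChainCondition κ (∀ i, IndepPoset χ (LevelAdj D) (X i)) := by
  intro hcc
  let p : Δ → ∀ i, IndepPoset χ (LevelAdj D) (X i) := fun α i =>
    .single hχ.aleph0_le (i, α.1) (hX i α.1 α.2)
  have hp : Function.Injective p := fun α β h => by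
    obtain ⟨i⟩ := ‹Nonempty Θ›
    have h : ({(i, α.1)} : Set (Θ × κ.ord.ToType)) = {(i, β.1)} :=
      congrArg (fun q : ∀ i, IndepPoset χ (LevelAdj D) (X i) => (q i).1) h
    exact Subtype.ext (congrArg Prod.snd (Set.singleton_injective h))
  have key : ∀ α β : Δ, α < β → ¬ CompatIn Set.univ (p α) (p β) := by
    rintro α β h ⟨r, -, hrα, hrβ⟩
    obtain ⟨i, hi⟩ := hD.cover (show α.1 < β.1 from h)
    exact (r i).2.2.2 (hrα i rfl) (hrβ i rfl) (fun h' => h.ne (Subtype.ext (congrArg Prod.snd h')))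
      ⟨rfl, Or.inl hi⟩
  refine (hcc (Set.range p) ?_).ne ?_
  · rintro _ ⟨α, rfl⟩ _ ⟨β, rfl⟩ hne
    rcases (show α ≠ β from fun h => hne (h ▸ rfl)).lt_or_gt with h | h
    · exact key α β h
    · exact fun ⟨r, hr, h₁, h₂⟩ => key β α h ⟨r, hr, h₂, h₁⟩
  · rw [mk_range_eq p hp, hΔ]

/-- If `κ ≤ 2 ^ θ`, then posets consisting of a greatest element and two incompatible ones have
a full product of length `θ` with an antichain of size `κ`, while shorter products are small. -/
theorem exists_posets_of_le_two_power (hχ : χ.IsRegular) (hθχ : θ ≤ χ) (hχκ : χ < κ)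
    (hinacc : LtInaccessible κ χ) (h : κ ≤ 2 ^ θ) :
    ∃ (P : θ.ord.ToType → Type u) (_ : ∀ i, PartialOrder (P i)),
      (∀ i, WellMet (P i) ∧ DirectedClosedGLB χ (P i)) ∧
      (∀ j : θ.ord.ToType, StationarilyLayered κ ((i : Set.Iio j) → P i)) ∧
      ¬ ChainCondition κ ((i : θ.ord.ToType) → P i) := by
  let R : ULift.{u} Bool → ULift.{u} Bool → Prop := fun _ _ => True
  refine ⟨fun _ => IndepPoset χ R Set.univ, fun _ => inferInstance,
    fun _ => ⟨IndepPoset.wellMet hχ.aleph0_le, IndepPoset.directedClosedGLB hχ⟩,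
    fun j => stationarilyLayered_of_mk_lt ?_, fun hcc => ?_⟩
  · have hfin : #(IndepPoset χ R Set.univ) < κ :=
      (mk_subtype_le _).trans_lt ((lt_aleph0_of_finite _).trans (hχ.aleph0_le.trans_lt hχκ))
    simpa using hinacc _ hfin _ ((mk_Iio_ord_lt j).trans_le hθχ)
  · let p : (θ.ord.ToType → Bool) → θ.ord.ToType → IndepPoset χ R Set.univ := fun s i =>
      .single hχ.aleph0_le ⟨s i⟩ trivial
    have hp : Function.Injective p := fun s t h => by
      funext i
      have h : ({⟨s i⟩} : Set (ULift.{u} Bool)) = {⟨t i⟩} := congrArg (fun q => (q i).1) h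
      exact congrArg ULift.down (Set.singleton_injective h)
    refine (hcc (Set.range p) ?_).not_ge ?_
    · rintro _ ⟨s, rfl⟩ _ ⟨t, rfl⟩ hne ⟨r, -, hs, ht⟩
      obtain ⟨i, hi⟩ := Function.ne_iff.1 (show s ≠ t from fun h => hne (h ▸ rfl))
      exact (r i).2.2.2 (hs i rfl) (ht i rfl) (fun h => hi (congrArg ULift.down h)) trivial
    · rw [mk_range_eq p hp]
      simpa using h

end Antichains

/-! ### The two constructions -/

theorem theoremD (κ θ χ : Cardinal.{u})
    (hκ : κ.IsRegular) (hθ : θ.IsRegular) (hχ : χ.IsRegular)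
    (hθχ : θ ≤ χ) (hχκ : χ < κ) (hinacc : LtInaccessible κ χ)
    (c : Ordinal.{u} → Ordinal.{u} → Ordinal.{u})
    (hU : WitnessesU κ 2 θ 2 c) (hclosed : IsClosedColoring κ θ c)
    (hsub : IsSubadditiveSnd κ c) :
    (∃ (P : θ.ord.ToType → Type u) (_ : ∀ i, PartialOrder (P i)),
      (∀ i, WellMet (P i) ∧ DirectedClosedGLB χ (P i)) ∧
      (∀ j : θ.ord.ToType, StationarilyLayered κ ((i : Set.Iio j) → P i)) ∧
      ¬ ChainCondition κ ((i : θ.ord.ToType) → P i)) ∧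
    (StationaryIn κ (divergenceLevels κ θ c ∩ cofSet κ χ) →
      ∃ (P : Type u) (_ : PartialOrder P),
        WellMet P ∧ DirectedClosedGLB χ P ∧
        (∀ j : θ.ord.ToType, StationarilyLayered κ (Set.Iio j → P)) ∧
        ¬ ChainCondition κ (θ.ord.ToType → P)) := by
  have hθκ := hθχ.trans_lt hχκ
  have hΘ : #θ.ord.ToType < κ := by simpa using hθκ
  have : Nonempty θ.ord.ToType := by simpa using hθ.ne_zero
  obtain ⟨j₀, Γ, hΓ, hD⟩ := exists_isLevelSystem hκ hθκ hU hclosed hsub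
  constructor
  · rcases le_or_gt κ (2 ^ θ) with h2 | h2
    · exact exists_posets_of_le_two_power hχ hθχ hχκ hinacc h2
    choose S hS hSχ hpair using fun i => hD.exists_stationary_pair hκ hχ hχκ i
    choose f hf using fun (β : Γ) (i : θ.ord.ToType) => hpair i β.1 β.2
    -- as `2 ^ θ < κ`, the same choice of stationary sets works for `κ` many points
    obtain ⟨b, hb⟩ := infinite_pigeonhole_card f κ hΓ.ge hκ.aleph0_le
      (by simpa [hκ.cof_ord] using h2)
    let Δ : Set κ.ord.ToType := Subtype.val '' (f ⁻¹' {b})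
    have hΔΓ : Δ ⊆ Γ := by
      rintro _ ⟨β, -, rfl⟩
      exact β.2
    have hΔ : #Δ = κ := by
      refine le_antisymm ((mk_le_mk_of_subset hΔΓ).trans hΓ.le) ?_
      rwa [mk_image_eq Subtype.val_injective]
    refine ⟨fun i => IndepPoset χ (LevelAdj (coloringLevel c j₀)) ({i} ×ˢ Δ), fun i => inferInstance,
      fun i => ⟨IndepPoset.wellMet hχ.aleph0_le, IndepPoset.directedClosedGLB hχ⟩, fun j => ?_,
      hD.not_chainCondition hχ hΔ _ fun i α hα => ⟨rfl, hα⟩⟩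
    refine hD.stationarilyLayered_pi hκ hχ hχκ hinacc hΘ ((mk_Iio_ord_lt j).trans_le hθχ)
      (fun t : Set.Iio j => {t.1} ×ˢ Δ) (fun t a ha => hΔΓ ha.2) (hS j (b j)) (hSχ j (b j)) ?_
    rintro δ hδ t ⟨_, _⟩ ⟨rfl, ⟨β, rfl, rfl⟩⟩ hδβ
    obtain ⟨ξ, hξ, hle⟩ := hf β j δ hδ hδβ
    exact ⟨ξ, hξ, fun α hα => hle α (hD.mono (le_of_lt t.2) hα)⟩
  · intro hst
    refine ⟨IndepPoset χ (LevelAdj (coloringLevel (κ := κ) (θ := θ) c j₀)) (Set.univ ×ˢ Γ),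
      inferInstance, IndepPoset.wellMet hχ.aleph0_le, IndepPoset.directedClosedGLB hχ, fun j => ?_,
      hD.not_chainCondition hχ hΓ (fun _ => _) fun i α hα => ⟨trivial, hα⟩⟩
    refine hD.stationarilyLayered_pi hκ hχ hχκ hinacc hΘ ((mk_Iio_ord_lt j).trans_le hθχ)
      (fun t : Set.Iio j => Set.univ ×ˢ Γ) (fun t a ha => ha.2)
      (meetsClosurePoints_of_stationaryIn hκ (hχ.aleph0_le.trans_lt hχκ) hst) ?_
      fun δ hδ t a ha _ => boundedAt_coloringLevel hδ.1 _ _ _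
    exact fun δ hδ => hasCofGE_of_le_cof hδ.2.2.ge
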